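/- Let $V$ be a real vector space of finite dimension $m$. Let $\mathfrak a(V)\subset\otimes^4V^*$ be the space of algebraic curvature tensors on $V$, i.e. of quadrilinear forms $A$ such that for all $x,y,z,w\in V$ $$A(x,y,z,w)=-A(y,x,z,w),\qquad A(x,y,z,w)+A(y,z,x,w)+A(z,x,y,w)=0,$$ $$A(x,y,z,w)=A(z,w,x,y),\qquad A(x,y,z,w)=-A(x,y,w,z).$$ Let $S^2(V^*)$ be the space of symmetric bilinear forms on $V$. For $\phi,\psi\in S^2(V^*)$ define $\phi\wedge\psi\in\mathfrak a(V)$ by $$(\phi\wedge\psi)(x,y,z,w):=\tfrac12\{\phi(x,w)\psi(y,z)-\phi(x,z)\psi(y,w)+\phi(y,z)\psi(x,w)-\phi(y,w)\psi(x,z)\}.$$ Theorem 3.5. (1) If $A\in\mathfrak a(V)$, then there is a finite (possibly empty) collection of elements $\phi_\nu\in S^2(V^*)$ with $\operatorname{Rank}\{\phi_\nu\}=2$ for every $\nu$ such that $A=\sum_\nu\phi_\nu\wedge\phi_\nu$. (2) Let $p,q\ge 0$ be integers with $2\le p+q\le m$, and let $S^2_{(p,q)}(V^*)$ be the set of all (possibly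 degenerate) symmetric bilinear forms on $V$ of signature $(p,q)$, i.e. such that $p$ and $q$ are the maximal dimensions of subspaces on which the form is positive, respectively negative, definite. Then $$\mathfrak a(V)=\operatorname{Span}_{\mathbb R}\{\phi\wedge\phi:\phi\in S^2_{(p,q)}(V^*)\}.$$ -/

import Mathlib

/-- Quadrilinear forms on a real vector space `V`, the elements of `⊗⁴ V*` (for finite-dimensional
`V`), in curried form: the value on `(x, y, z, w)` is `A x y z w`. -/
abbrev QuadrilinForm (V : Type*) [AddCommGroup V] [Module ℝ V] : Type _ :=
  V →ₗ[ℝ] V →ₗ[ℝ] V →ₗ[ℝ] V →ₗ[ℝ] ℝ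

/-- The space `𝔞(V)` of algebraic curvature tensors on `V`. -/
def algCurvTensors (V : Type*) [AddCommGroup V] [Module ℝ V] :
    Submodule ℝ (QuadrilinForm V) where
  carrier := {A | ∀ x y z w : V,
    A x y z w = -A y x z w ∧
    A x y z w + A y z x w + A z x y w = 0 ∧
    A x y z w = A z w x y ∧
    A x y z w = -A x y w z}
  zero_mem' := by
    intro x y z w
    simp
  add_mem' := by
    intro A B hA hB x y z w
    obtain ⟨a1, a2, a3, a4⟩ := hA x y z w
    obtain ⟨b1, b2, b3, b4⟩ := hB x y z w
    simp only [LinearMap.add_apply]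
    refine ⟨?_, ?_, ?_, ?_⟩ <;> linarith
  smul_mem' := by
    intro c A hA x y z w
    obtain ⟨a1, a2, a3, a4⟩ := hA x y z w
    simp only [LinearMap.smul_apply, smul_eq_mul]
    refine ⟨?_, ?_, ?_, ?_⟩
    · rw [a1]; ring
    · linear_combination c * a2
    · rw [a3]
    · rw [a4]; ring

/-- The product `φ ∧ ψ` of two bilinear forms, a quadrilinear form. -/
noncomputable def curvWedge {V : Type*} [AddCommGroup V] [Module ℝ V] (φ ψ : LinearMap.BilinForm ℝ V) :
    QuadrilinForm V :=
  LinearMap.mk₂ ℝ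
    (fun x y => LinearMap.mk₂ ℝ
      (fun z w => (1 / 2 : ℝ) *
        (φ x w * ψ y z - φ x z * ψ y w + φ y z * ψ x w - φ y w * ψ x z))
      (by intros; simp only [map_add]; ring)
      (by intros; simp only [map_smul, smul_eq_mul]; ring)
      (by intros; simp only [map_add]; ring)
      (by intros; simp only [map_smul, smul_eq_mul]; ring))
    (by intros; ext; simp; ring)
    (by intros; ext; simp; ring)
    (by intros; ext; simp; ring)
    (by intros; ext; simp; ring)

theorem curvWedge_apply {V : Type*} [AddCommGroup V] [Module ℝ V]
    (φ ψ : LinearMap.BilinForm ℝ V) (x y z w : V) :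
    curvWedge φ ψ x y z w = (1 / 2 : ℝ) *
      (φ x w * ψ y z - φ x z * ψ y w + φ y z * ψ x w - φ y w * ψ x z) := rfl

theorem curvWedge_mem {V : Type*} [AddCommGroup V] [Module ℝ V]
    {φ ψ : LinearMap.BilinForm ℝ V} (hφ : φ.IsSymm) (hψ : ψ.IsSymm) :
    curvWedge φ ψ ∈ algCurvTensors V := by
  intro x y z w
  simp only [curvWedge_apply]
  refine ⟨by ring, ?_, ?_, by ring⟩
  · rw [hφ.eq z x, hφ.eq y x, hφ.eq z y, hψ.eq z x, hψ.eq y x, hψ.eq z y]; ring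
  · rw [hφ.eq z y, hφ.eq z x, hφ.eq w x, hφ.eq w y, hψ.eq z y, hψ.eq z x, hψ.eq w x, hψ.eq w y]
    ring

/-- The set `S²_{(p,q)}(V*)` of symmetric bilinear forms of signature `(p, q)`, possibly
degenerate: `p` and `q` are the largest dimensions of subspaces on which the form is positive,
respectively negative, definite. -/
def symFormsOfSignature (V : Type*) [AddCommGroup V] [Module ℝ V] (p q : ℕ) :
    Set (LinearMap.BilinForm ℝ V) :=
  {φ | φ.IsSymm ∧ sigPos (LinearMap.BilinMap.toQuadraticMap φ) = p ∧
    sigNeg (LinearMap.BilinMap.toQuadraticMap φ) = q}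

/-
For `A ∈ 𝔞(V)` let `K(u, v) = A(u, ·, v, ·) + A(v, ·, u, ·)`, the polarized sectional curvatures.
The Bianchi identity recovers `A` from them, `3 A(x, y, z, w) = K(x, z)(y, w) - K(y, z)(x, w)`, and
expanding in a basis `e` turns this into `-6 A = ∑ K(eᵢ, eⱼ) ∧ (eⁱ ⊙ eʲ)`, a sum of products of
symmetric forms. As `∧` is bilinear and symmetric forms can be diagonalized, `𝔞(V)` is spanned by
the `α² ∧ β²` with `α`, `β` linearly independent linear forms.

(1) Since `α² ∧ α² = 0`, we have `c (α² ∧ β²) = φ ∧ φ` for the rank two form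
`φ = α² + (c / 2) β²`.

(2) Complete `α`, `β` to coordinates and take a diagonal form `φ` of signature `(p, q)` whose
weights `s`, `t` at `α²`, `β²` are nonzero. Doubling `s` or `t` keeps the signature, and
`2 s t (α² ∧ β²)` is the second difference of `ψ ↦ ψ ∧ ψ` at `φ` in the directions `s α²`, `t β²`.
-/

open Module

section DiagonalForms

variable {K V : Type*} [Field K] [AddCommGroup V] [Module K V]

/-- The square `α² = α ⊗ α` of a linear form `α`, as a bilinear form. -/
def dualSquare (α : Dual K V) : LinearMap.BilinForm K V :=
  α.smulRight α

@[simp]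
theorem dualSquare_apply (α : Dual K V) (x y : V) : dualSquare α x y = α x * α y := by
  simp [dualSquare]

theorem isSymm_dualSquare (α : Dual K V) : (dualSquare α).IsSymm :=
  ⟨fun x y => by simp [mul_comm]⟩

theorem dualSquare_smul (c : K) (α : Dual K V) : dualSquare (c • α) = c ^ 2 • dualSquare α := by
  ext x y
  simp only [dualSquare_apply, LinearMap.smul_apply, smul_eq_mul]
  ring

theorem polar_dualSquare_apply (α β : Dual K V) (x y : V) :
    QuadraticMap.polar dualSquare α β x y = α x * β y + α y * β x := by
  simp only [QuadraticMap.polar, LinearMap.sub_apply, LinearMap.add_apply, dualSquare_apply]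
  ring

theorem isSymm_polar_dualSquare (α β : Dual K V) :
    (QuadraticMap.polar dualSquare α β).IsSymm :=
  ((isSymm_dualSquare _).sub (isSymm_dualSquare _)).sub (isSymm_dualSquare _)

variable {ι : Type*} [Fintype ι]

/-- The bilinear form `∑ wᵢ (eⁱ)²` that is diagonal in the basis `b`, with weights `w`; the `eⁱ`
are the coordinates of `b`. -/
noncomputable def diagForm (b : Basis ι K V) (w : ι → K) : LinearMap.BilinForm K V :=
  ∑ i, w i • dualSquare (b.coord i)

theorem diagForm_apply (b : Basis ι K V) (w : ι → K) (x y : V) :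
    diagForm b w x y = ∑ i, w i * (b.repr x i * b.repr y i) := by
  simp [diagForm]

theorem diagForm_add (b : Basis ι K V) (v w : ι → K) :
    diagForm b (v + w) = diagForm b v + diagForm b w := by
  simp [diagForm, add_smul, Finset.sum_add_distrib]

theorem diagForm_single [DecidableEq ι] (b : Basis ι K V) (i : ι) (c : K) :
    diagForm b (Pi.single i c) = c • dualSquare (b.coord i) := by
  simp [diagForm, Pi.single_apply]

theorem isSymm_diagForm (b : Basis ι K V) (w : ι → K) : (diagForm b w).IsSymm :=
  ⟨fun x y => by simp [diagForm_apply, mul_comm (b.repr x _)]⟩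

theorem finrank_range_diagForm (b : Basis ι K V) (w : ι → K) :
    finrank K (LinearMap.range (diagForm b w)) = {i | w i ≠ 0}.ncard := by
  classical
  have toLin_eq : Matrix.toLin b b.dualBasis (Matrix.diagonal w) = diagForm b w := by
    refine b.ext fun i => b.ext fun j => ?_
    rcases eq_or_ne i j with rfl | hij
    · simp [diagForm_apply, Matrix.toLin_self, Finsupp.single_apply]
    · simp [diagForm_apply, Matrix.toLin_self, Finsupp.single_apply, hij, hij.symm]
  rw [← toLin_eq, ← Matrix.rank_eq_finrank_range_toLin, Matrix.rank_diagonal,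
    ← Nat.card_eq_fintype_card]
  rfl

theorem exists_eq_diagForm [FiniteDimensional K V] [Invertible (2 : K)]
    {φ : LinearMap.BilinForm K V} (hφ : φ.IsSymm) :
    ∃ (b : Basis (Fin (finrank K V)) K V) (w : Fin (finrank K V) → K), φ = diagForm b w := by
  obtain ⟨b, hb⟩ := LinearMap.BilinForm.exists_orthogonal_basis
    (LinearMap.BilinForm.isSymm_iff.mp hφ)
  refine ⟨b, fun i => φ (b i) (b i), b.ext fun i => b.ext fun j => ?_⟩
  rcases eq_or_ne i j with rfl | hij
  · simp [diagForm_apply, Finsupp.single_apply]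
  · simpa [diagForm_apply, Finsupp.single_apply, hij] using hb hij

theorem mem_span_range_dualSquare [FiniteDimensional K V] [Invertible (2 : K)]
    {φ : LinearMap.BilinForm K V} (hφ : φ.IsSymm) :
    φ ∈ Submodule.span K (Set.range (dualSquare (K := K) (V := V))) := by
  obtain ⟨b, w, rfl⟩ := exists_eq_diagForm hφ
  exact sum_mem fun i _ => Submodule.smul_mem _ _ (Submodule.subset_span ⟨_, rfl⟩)

theorem exists_basis_coord_eq [FiniteDimensional K V] {κ : Type*} {f : κ → Dual K V}
    (hf : LinearIndependent K f) :
    ∃ (b : Basis (Fin (finrank K V)) K V) (e : κ ↪ Fin (finrank K V)),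
      ∀ k, b.coord (e k) = f k := by
  let B := Basis.sumExtend hf
  have hB (k : κ) : B (Sum.inl k) = f k := by
    simp only [B, Basis.sumExtend, Equiv.trans_def, Basis.coe_reindex, Basis.coe_extend,
      Function.comp_apply]
    rfl
  have := Module.Finite.finite_basis B
  let e := (Finite.equivFinOfCardEq (finrank_eq_nat_card_basis B).symm).trans
    (finCongr Subspace.dual_finrank_eq)
  refine ⟨(B.reindex e).dualBasis.map (evalEquiv K V).symm,
    Function.Embedding.inl.trans e.toEmbedding, fun k => ?_⟩
  ext v
  simp [hB]

end DiagonalForms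

section Signature

variable {V : Type*} [AddCommGroup V] [Module ℝ V] {ι : Type*} [Fintype ι]

theorem diagForm_mem_symFormsOfSignature_iff {b : Basis ι ℝ V} {w : ι → ℝ} {p q : ℕ} :
    diagForm b w ∈ symFormsOfSignature V p q ↔
      {i | 0 < w i}.ncard = p ∧ {i | w i < 0}.ncard = q := by
  have e : (LinearMap.BilinMap.toQuadraticMap (diagForm b w)).Equivalent
      (QuadraticMap.weightedSumSquares ℝ w) :=
    ⟨⟨b.equivFun, fun v => by
      simp [QuadraticMap.weightedSumSquares_apply, diagForm_apply]⟩⟩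
  rw [← QuadraticForm.sigPos_of_equiv_weightedSumSquares e,
    ← QuadraticForm.sigNeg_of_equiv_weightedSumSquares e]
  exact and_iff_right (isSymm_diagForm b w)

theorem diagForm_add_single_mem_symFormsOfSignature [DecidableEq ι] {b : Basis ι ℝ V} {w : ι → ℝ}
    {p q : ℕ} (h : diagForm b w ∈ symFormsOfSignature V p q) (i : ι) :
    diagForm b (w + Pi.single i (w i)) ∈ symFormsOfSignature V p q := by
  rw [diagForm_mem_symFormsOfSignature_iff] at h ⊢
  convert h using 5 with k k <;> rcases eq_or_ne k i with rfl | hk <;> simp [*]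

theorem exists_weights_of_card_le {p q : ℕ} {s : Finset ι} (hs : s.card ≤ p + q)
    (hpq : p + q ≤ Fintype.card ι) :
    ∃ w : ι → ℝ, (∀ i ∈ s, w i ≠ 0) ∧ {i | 0 < w i}.ncard = p ∧ {i | w i < 0}.ncard = q := by
  classical
  obtain ⟨t, hst, ht⟩ := Finset.exists_superset_card_eq hs hpq
  obtain ⟨P, hPt, hP⟩ := Finset.exists_subset_card_eq (ht.symm ▸ Nat.le_add_right p q)
  have hN : (t \ P).card = q := by
    rw [Finset.card_sdiff_of_subset hPt, ht, hP, Nat.add_sub_cancel_left]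
  refine ⟨fun i => if i ∈ P then 1 else if i ∈ t then -1 else 0, fun i hi => ?_, ?_, ?_⟩
  · have := hst hi
    dsimp only
    split_ifs <;> norm_num
  · rw [← hP, ← Set.ncard_coe_finset]
    congr 1 with i
    by_cases hiP : i ∈ P <;> by_cases hit : i ∈ t <;> simp [hiP, hit]
  · rw [← hN, ← Set.ncard_coe_finset]
    congr 1 with i
    by_cases hiP : i ∈ P <;> by_cases hit : i ∈ t <;> simp [hiP, hit]

end Signature

section CurvatureTensors

variable {V : Type*} [AddCommGroup V] [Module ℝ V]

/-- The product `curvWedge`, bundled as a bilinear map. -/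
noncomputable def curvWedgeHom :
    LinearMap.BilinForm ℝ V →ₗ[ℝ] LinearMap.BilinForm ℝ V →ₗ[ℝ] QuadrilinForm V :=
  LinearMap.mk₂ ℝ curvWedge
    (fun _ _ _ => by ext; simp only [curvWedge_apply, LinearMap.add_apply]; ring)
    (fun _ _ _ => by ext; simp only [curvWedge_apply, LinearMap.smul_apply, smul_eq_mul]; ring)
    (fun _ _ _ => by ext; simp only [curvWedge_apply, LinearMap.add_apply]; ring)
    (fun _ _ _ => by ext; simp only [curvWedge_apply, LinearMap.smul_apply, smul_eq_mul]; ring)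

theorem curvWedgeHom_apply (φ ψ : LinearMap.BilinForm ℝ V) :
    curvWedgeHom φ ψ = curvWedge φ ψ := rfl

theorem curvWedge_smul_smul (c d : ℝ) (φ ψ : LinearMap.BilinForm ℝ V) :
    curvWedge (c • φ) (d • ψ) = (c * d) • curvWedge φ ψ := by
  ext
  simp only [curvWedge_apply, LinearMap.smul_apply, smul_eq_mul]
  ring

-- The depth is needed to find the subtraction of nested linear maps.
set_option maxSynthPendingDepth 5 in
theorem two_smul_curvWedge_eq_second_difference (φ ψ χ : LinearMap.BilinForm ℝ V) :
    (2 : ℝ) • curvWedge ψ χ = curvWedge (φ + ψ + χ) (φ + ψ + χ) - curvWedge (φ + ψ) (φ + ψ) -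
      curvWedge (φ + χ) (φ + χ) + curvWedge φ φ := by
  ext
  simp only [curvWedge_apply, LinearMap.add_apply, LinearMap.sub_apply, LinearMap.smul_apply,
    smul_eq_mul]
  ring

theorem curvWedge_dualSquare_self (α : Dual ℝ V) :
    curvWedge (dualSquare α) (dualSquare α) = 0 := by
  ext
  simp only [curvWedge_apply, dualSquare_apply, LinearMap.zero_apply]
  ring

theorem curvWedge_dualSquare_eq_zero {α β : Dual ℝ V} (h : ¬ LinearIndependent ℝ ![α, β]) :
    curvWedge (dualSquare α) (dualSquare β) = 0 := by
  rcases eq_or_ne α 0 with rfl | hα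
  · ext; simp [curvWedge_apply]
  · obtain ⟨c, rfl⟩ : ∃ c : ℝ, c • α = β := by
      simpa [LinearIndependent.pair_iff' hα] using h
    rw [dualSquare_smul, ← curvWedgeHom_apply, map_smul, curvWedgeHom_apply,
      curvWedge_dualSquare_self, smul_zero]

/-- The symmetrization in `u`, `v` of the bilinear form `A(u, ·, v, ·)`. For `u = v` it is `-2`
times the form `A(·, u, u, ·)` of the Jacobi operator of `A`, so it carries the polarized sectional
curvatures. -/
noncomputable def jacobiForm (A : QuadrilinForm V) (u v : V) : LinearMap.BilinForm ℝ V :=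
  (A u).flip v + (A v).flip u

theorem jacobiForm_apply (A : QuadrilinForm V) (u v x y : V) :
    jacobiForm A u v x y = A u x v y + A v x u y := rfl

theorem jacobiForm_comm (A : QuadrilinForm V) (u v : V) : jacobiForm A u v = jacobiForm A v u :=
  add_comm _ _

theorem jacobiForm_apply_swap {A : QuadrilinForm V} (hA : A ∈ algCurvTensors V) (u v x y : V) :
    jacobiForm A u v x y = jacobiForm A x y u v := by
  simp only [jacobiForm_apply]
  have flip_both : A u x v y = A x u y v := by
    rw [(hA u x v y).1, (hA x u v y).2.2.2, neg_neg]
  have flip_pairs : A v x u y = A y u x v := by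
    rw [(hA v x u y).2.2.1, (hA u y v x).1, (hA y u v x).2.2.2, neg_neg]
  rw [flip_both, flip_pairs]

theorem isSymm_jacobiForm {A : QuadrilinForm V} (hA : A ∈ algCurvTensors V) (u v : V) :
    (jacobiForm A u v).IsSymm := by
  refine ⟨fun x y => ?_⟩
  simp only [jacobiForm_apply]
  rw [(hA u x v y).2.2.1, (hA v x u y).2.2.1, add_comm]

theorem jacobiForm_sub_jacobiForm {A : QuadrilinForm V} (hA : A ∈ algCurvTensors V)
    (x y z w : V) :
    jacobiForm A x z y w - jacobiForm A y z x w = 3 * A x y z w := by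
  simp only [jacobiForm_apply]
  linarith [(hA x y z w).1, (hA x y z w).2.1, (hA y z x w).1]

theorem sum_jacobiForm_mul_polar_dualSquare {ι : Type*} [Fintype ι] (b : Basis ι ℝ V)
    {A : QuadrilinForm V} (hA : A ∈ algCurvTensors V) (x y z w : V) :
    ∑ i, ∑ j, jacobiForm A (b i) (b j) x y *
      QuadraticMap.polar dualSquare (b.coord i) (b.coord j) z w = 2 * jacobiForm A z w x y := by
  classical
  have expand (u v : V) : jacobiForm A u v x y =
      ∑ i, ∑ j, jacobiForm A (b i) (b j) x y * (b.repr u i * b.repr v j) := by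
    simp only [jacobiForm_apply_swap hA _ _ x y]
    conv_lhs => rw [← Matrix.toBilin_toMatrix b (jacobiForm A x y), Matrix.toBilin_apply]
    simp only [LinearMap.BilinForm.toMatrix_apply]
    exact Finset.sum_congr rfl fun i _ => Finset.sum_congr rfl fun j _ => by ring
  simp only [polar_dualSquare_apply, Basis.coord_apply, mul_add, Finset.sum_add_distrib, ← expand]
  rw [jacobiForm_comm A w z, two_mul]

theorem neg_six_smul_eq_sum_curvWedge {ι : Type*} [Fintype ι] (b : Basis ι ℝ V)
    {A : QuadrilinForm V} (hA : A ∈ algCurvTensors V) :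
    (-6 : ℝ) • A = ∑ i, ∑ j, curvWedge (jacobiForm A (b i) (b j))
      (QuadraticMap.polar dualSquare (b.coord i) (b.coord j)) := by
  ext x y z w
  simp only [LinearMap.sum_apply, LinearMap.smul_apply, smul_eq_mul, curvWedge_apply,
    ← Finset.mul_sum, Finset.sum_add_distrib, Finset.sum_sub_distrib,
    sum_jacobiForm_mul_polar_dualSquare b hA]
  linarith [jacobiForm_sub_jacobiForm hA x y z w, jacobiForm_apply_swap hA x w y z,
    jacobiForm_apply_swap hA x z y w]

theorem curvWedge_mem_span_curvWedge_dualSquare [FiniteDimensional ℝ V]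
    {φ ψ : LinearMap.BilinForm ℝ V} (hφ : φ.IsSymm) (hψ : ψ.IsSymm) :
    curvWedge φ ψ ∈ Submodule.span ℝ {T | ∃ α β : Dual ℝ V, LinearIndependent ℝ ![α, β] ∧
      T = curvWedge (dualSquare α) (dualSquare β)} := by
  have mem_map₂ := Submodule.apply_mem_map₂ curvWedgeHom
    (mem_span_range_dualSquare hφ) (mem_span_range_dualSquare hψ)
  rw [Submodule.map₂_span_span] at mem_map₂
  refine Submodule.span_le.mpr ?_ mem_map₂
  rintro _ ⟨_, ⟨α, rfl⟩, _, ⟨β, rfl⟩, rfl⟩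
  by_cases h : LinearIndependent ℝ ![α, β]
  · exact Submodule.subset_span ⟨α, β, h, rfl⟩
  · simp only [curvWedgeHom_apply, curvWedge_dualSquare_eq_zero h, SetLike.mem_coe, zero_mem]

theorem algCurvTensors_le_span_curvWedge_dualSquare [FiniteDimensional ℝ V] :
    algCurvTensors V ≤ Submodule.span ℝ {T | ∃ α β : Dual ℝ V, LinearIndependent ℝ ![α, β] ∧
      T = curvWedge (dualSquare α) (dualSquare β)} := by
  intro A hA
  rw [← Submodule.smul_mem_iff _ (show (-6 : ℝ) ≠ 0 by norm_num),
    neg_six_smul_eq_sum_curvWedge (finBasis ℝ V) hA]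
  exact sum_mem fun i _ => sum_mem fun j _ =>
    curvWedge_mem_span_curvWedge_dualSquare (isSymm_jacobiForm hA _ _) (isSymm_polar_dualSquare _ _)

theorem exists_finrank_two_smul_curvWedge_eq_self [FiniteDimensional ℝ V] {α β : Dual ℝ V}
    (h : LinearIndependent ℝ ![α, β]) {c : ℝ} (hc : c ≠ 0) :
    ∃ φ : LinearMap.BilinForm ℝ V, (φ.IsSymm ∧ finrank ℝ (LinearMap.range φ) = 2) ∧
      c • curvWedge (dualSquare α) (dualSquare β) = curvWedge φ φ := by
  obtain ⟨b, e, hb⟩ := exists_basis_coord_eq h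
  have he : e 0 ≠ e 1 := e.injective.ne zero_ne_one
  refine ⟨diagForm b (Pi.single (e 0) 1 + Pi.single (e 1) (c / 2)),
    ⟨isSymm_diagForm _ _, ?_⟩, ?_⟩
  · rw [finrank_range_diagForm, ← Set.ncard_pair he]
    congr 1 with k
    by_cases h0 : k = e 0 <;> by_cases h1 : k = e 1 <;> simp_all
  · rw [diagForm_add, diagForm_single, diagForm_single, hb, hb]
    ext
    simp only [curvWedge_apply, LinearMap.add_apply, LinearMap.smul_apply, dualSquare_apply,
      smul_eq_mul, Matrix.cons_val_zero, Matrix.cons_val_one]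
    ring

theorem exists_eq_sum_curvWedge_self [FiniteDimensional ℝ V] {A : QuadrilinForm V}
    (hA : A ∈ algCurvTensors V) :
    ∃ (k : ℕ) (φ : Fin k → LinearMap.BilinForm ℝ V),
      (∀ ν, (φ ν).IsSymm ∧ finrank ℝ (LinearMap.range (φ ν)) = 2) ∧
      A = ∑ ν, curvWedge (φ ν) (φ ν) := by
  obtain ⟨c, hc, rfl⟩ := Submodule.mem_span_set.mp (algCurvTensors_le_span_curvWedge_dualSquare hA)
  have coeff_smul_eq (T : c.support) : ∃ φ : LinearMap.BilinForm ℝ V,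
      (φ.IsSymm ∧ finrank ℝ (LinearMap.range φ) = 2) ∧
      c T • (T : QuadrilinForm V) = curvWedge φ φ := by
    obtain ⟨α, β, h, hT⟩ := hc T.2
    have hcT : c T ≠ 0 := Finsupp.mem_support_iff.mp T.2
    simpa only [hT] using exists_finrank_two_smul_curvWedge_eq_self h hcT
  choose φ hφ hcφ using coeff_smul_eq
  refine ⟨c.support.card, φ ∘ c.support.equivFin.symm, fun ν => hφ _, ?_⟩
  rw [Finsupp.sum, ← Finset.sum_coe_sort, ← c.support.equivFin.symm.sum_comp]
  exact Finset.sum_congr rfl fun ν _ => hcφ _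

set_option maxSynthPendingDepth 5 in
theorem curvWedge_dualSquare_mem_span_symFormsOfSignature [FiniteDimensional ℝ V] {p q : ℕ}
    (hpq : 2 ≤ p + q) (hm : p + q ≤ finrank ℝ V) {α β : Dual ℝ V}
    (h : LinearIndependent ℝ ![α, β]) :
    curvWedge (dualSquare α) (dualSquare β) ∈
      Submodule.span ℝ {T | ∃ φ ∈ symFormsOfSignature V p q, T = curvWedge φ φ} := by
  obtain ⟨b, e, hb⟩ := exists_basis_coord_eq h
  set i := e 0
  set j := e 1
  have hij : i ≠ j := e.injective.ne zero_ne_one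
  obtain ⟨w, hw, hsig⟩ := exists_weights_of_card_le (s := {i, j}) (by rwa [Finset.card_pair hij])
    (by simpa using hm)
  have hφ : diagForm b w ∈ symFormsOfSignature V p q :=
    diagForm_mem_symFormsOfSignature_iff.mpr hsig
  have hφi := diagForm_add_single_mem_symFormsOfSignature hφ i
  have hφj := diagForm_add_single_mem_symFormsOfSignature hφ j
  have hφij := diagForm_add_single_mem_symFormsOfSignature hφi j
  simp only [Pi.add_apply, Pi.single_eq_of_ne' hij, add_zero, diagForm_add, diagForm_single, i, j,
    hb, Matrix.cons_val_zero, Matrix.cons_val_one] at hφi hφj hφij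
  have wedge_self_mem {φ : LinearMap.BilinForm ℝ V} (hφ : φ ∈ symFormsOfSignature V p q) :
      curvWedge φ φ ∈
        Submodule.span ℝ {T | ∃ φ ∈ symFormsOfSignature V p q, T = curvWedge φ φ} :=
    Submodule.subset_span ⟨φ, hφ, rfl⟩
  have second_difference_mem := add_mem (sub_mem (sub_mem (wedge_self_mem hφij)
    (wedge_self_mem hφi)) (wedge_self_mem hφj)) (wedge_self_mem hφ)
  rw [← two_smul_curvWedge_eq_second_difference, curvWedge_smul_smul, smul_smul]
    at second_difference_mem
  have coeff_ne_zero : 2 * (w i * w j) ≠ 0 := by simp [hw i, hw j]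
  exact (Submodule.smul_mem_iff _ coeff_ne_zero).mp second_difference_mem

end CurvatureTensors

theorem theorem3p5 (V : Type*) [AddCommGroup V] [Module ℝ V] [FiniteDimensional ℝ V] :
    (∀ A ∈ algCurvTensors V, ∃ (k : ℕ) (φ : Fin k → LinearMap.BilinForm ℝ V),
      (∀ ν, (φ ν).IsSymm ∧ Module.finrank ℝ (LinearMap.range (φ ν)) = 2) ∧
      A = ∑ ν, curvWedge (φ ν) (φ ν)) ∧
    (∀ p q : ℕ, 2 ≤ p + q → p + q ≤ Module.finrank ℝ V →
      algCurvTensors V =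
        Submodule.span ℝ {T | ∃ φ ∈ symFormsOfSignature V p q, T = curvWedge φ φ}) := by
  refine ⟨fun A hA => exists_eq_sum_curvWedge_self hA, fun p q hpq hm => le_antisymm ?_ ?_⟩
  · refine algCurvTensors_le_span_curvWedge_dualSquare.trans (Submodule.span_le.mpr ?_)
    rintro _ ⟨α, β, h, rfl⟩
    exact curvWedge_dualSquare_mem_span_symFormsOfSignature hpq hm h
  · refine Submodule.span_le.mpr ?_
    rintro _ ⟨φ, hφ, rfl⟩
    exact curvWedge_mem hφ.1 hφ.1
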